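/- Let $p$ be a prime, $G=\mathbb Z_p$, and let $\mathscr O_G$ be the orbit category of $G$ (objects $G/H$ for $H\le G$, morphisms the $G$-maps). A system of vector spaces is a covariant functor from $\mathscr O_G$ to rational vector spaces, and injectivity always means injectivity in the category of such functors. All DGAs are graded commutative over $\mathbb Q$ and graded in degrees $\ge 0$. Given a diagram $\mathcal U$ of DGAs over $\mathscr O_G$, a system of vector spaces $\underline V$ with minimal injective resolution $\underline V\to\underline V_0\xrightarrow{w_0}\underline V_1\xrightarrow{w_1}\cdots$, and maps $\alpha_i:\underline V_i\to\mathcal U^{n+i+1}$ with $d\alpha_i=\alpha_{i+1}w_i$, the elementary extension of $\mathcal U$ by $\underline V$ in degree $n$ is $\mathcal U(\underline V)=\mathcal U\otimes\bigotimes_i\mathbb Q(\underline V_i)$, where $\mathbb Q(\underline V_i)$ is the free graded commutative algebra on $\underline V_i$ placed in degree $n+i$ and $d=(-1)^i\alpha_i+w_i$ on $\underline V_i$. A diagram $\mathscr M$ of DGAs whose underlying system of vector spaces is injective is minimal if $\mathscr M=\bigcup_n\mathscr M_n$ with $\mathscr M_0=\mathscr M_1=\mathbb Q$ and, for each $n\ge2$,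 $\mathscr M_n=\mathscr M_{n-1}(\underline V)$ an elementary extension by some system of vector spaces $\underline V=\underline V^{(n)}$ in degree $n$. Let $\mathcal A$ be a diagram of graded commutative $\mathbb Q$-algebras over $\mathscr O_G$ (for instance $G/H\mapsto H^*(X^H;\mathbb Q)$ for a $G$-space $X$) whose underlying system of vector spaces is injective; regard it as a diagram of DGAs with zero differential. Let $\mathscr M=\bigcup_n\mathscr M_n$ be a minimal model of $\mathcal A$, that is, a minimal system with a map $\rho:\mathscr M\to\mathcal A$ inducing an isomorphism in cohomology at each $G/H$. Let $n\ge 2$ and let $\underline V=\underline V^{(n)}$ be the $n$-th stage associated system of vector spaces, $\mathscr M_n=\mathscr M_{n-1}(\underline V)$. If $\mathscr M_{n-1}(G/G)$ has no non-zero element of degree $n+1$, then $\underline V$ is injective. -/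

import Mathlib

open CategoryTheory CategoryTheory.Limits

universe u v

namespace EquivMin

/-! ### The orbit category -/

/-- An object of the orbit category of `G`: the `G`-set `G/H`, recorded by the subgroup `H`. -/
structure Orbit (G : Type v) [Group G] where
  /-- the subgroup `H` of the orbit `G/H` -/
  sub : Subgroup G

/-- The orbit category of `G`: morphisms `G/H ⟶ G/K` are the `G`-equivariant maps. -/
instance Orbit.category (G : Type v) [Group G] : Category.{v} (Orbit G) where
  Hom H K := (G ⧸ H.sub) →[G] (G ⧸ K.sub)
  id H := MulActionHom.id G
  comp f g := MulActionHom.comp g f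

/-- A dual rational coefficient system: a covariant functor from the orbit category to rational
vector spaces. This is an abelian category, and injectivity of a system of vector spaces is
`CategoryTheory.Injective` in it. -/
abbrev VectSystem (G : Type v) [Group G] := Orbit G ⥤ ModuleCat.{u} ℚ

/-! ### Graded commutative algebras and commutative differential graded algebras over `ℚ` -/

/-- A graded commutative `ℚ`-algebra, graded in degrees `0, 1, 2, …`. -/
structure GrAlg : Type (u + 1) where
  /-- the underlying type -/
  carrier : Type u
  [ring : Ring carrier]
  [algebra : Algebra ℚ carrier]
  /-- the homogeneous parts -/
  grade : ℕ → Submodule ℚ carrier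
  [gradedAlgebra : GradedAlgebra grade]
  graded_comm : ∀ {i j : ℕ} {x y : carrier}, x ∈ grade i → y ∈ grade j →
    x * y = (-1 : ℚ) ^ (i * j) • (y * x)

instance : CoeSort GrAlg.{u} (Type u) := ⟨GrAlg.carrier⟩

attribute [instance] GrAlg.ring GrAlg.algebra GrAlg.gradedAlgebra

/-- A degree-preserving algebra homomorphism. -/
@[ext]
structure GrAlg.Hom (A B : GrAlg.{u}) where
  /-- the underlying algebra homomorphism -/
  toAlgHom : A →ₐ[ℚ] B
  map_mem : ∀ {i : ℕ} {x : A}, x ∈ A.grade i → toAlgHom x ∈ B.grade i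

instance GrAlg.category : Category.{u} GrAlg.{u} where
  Hom A B := GrAlg.Hom A B
  id A := ⟨AlgHom.id ℚ A, fun h => h⟩
  comp f g := ⟨g.toAlgHom.comp f.toAlgHom, fun h => g.map_mem (f.map_mem h)⟩

/-- The underlying rational vector space of a graded algebra. -/
def GrAlg.vect : GrAlg.{u} ⥤ ModuleCat.{u} ℚ where
  obj A := ModuleCat.of ℚ A
  map f := ModuleCat.ofHom f.toAlgHom.toLinearMap

/-- A commutative differential graded algebra over `ℚ`: the differential raises degree by one,
squares to zero, and is a graded derivation. -/
structure DGAlg : Type (u + 1) extends GrAlg.{u} where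
  /-- the differential -/
  d : carrier →ₗ[ℚ] carrier
  d_mem : ∀ {i : ℕ} {x : carrier}, x ∈ grade i → d x ∈ grade (i + 1)
  d_d : ∀ x : carrier, d (d x) = 0
  leibniz : ∀ {i : ℕ} {x : carrier} (y : carrier), x ∈ grade i →
    d (x * y) = d x * y + (-1 : ℚ) ^ i • (x * d y)

instance : CoeSort DGAlg.{u} (Type u) := ⟨fun A => A.carrier⟩

/-- A morphism of differential graded algebras. -/
@[ext]
structure DGAlg.Hom (A B : DGAlg.{u}) extends GrAlg.Hom A.toGrAlg B.toGrAlg where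
  map_d : ∀ x : A, toAlgHom (A.d x) = B.d (toAlgHom x)

instance DGAlg.category : Category.{u} DGAlg.{u} where
  Hom A B := DGAlg.Hom A B
  id A := ⟨⟨AlgHom.id ℚ A, fun h => h⟩, fun _ => rfl⟩
  comp {A B C} f g := ⟨⟨g.toAlgHom.comp f.toAlgHom, fun h => g.map_mem (f.map_mem h)⟩,
    fun x => by
      change g.toAlgHom (f.toAlgHom (A.d x)) = C.d (g.toAlgHom (f.toAlgHom x))
      rw [f.map_d, g.map_d]⟩

/-- Forget the differential. -/
def DGAlg.forgetD : DGAlg.{u} ⥤ GrAlg.{u} where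
  obj A := A.toGrAlg
  map f := f.toHom

/-- The underlying rational vector space of a differential graded algebra. -/
abbrev DGAlg.vect : DGAlg.{u} ⥤ ModuleCat.{u} ℚ := DGAlg.forgetD ⋙ GrAlg.vect

/-- A graded commutative algebra regarded as a differential graded algebra with `d = 0`. -/
def GrAlg.zeroD : GrAlg.{u} ⥤ DGAlg.{u} where
  obj A :=
    { toGrAlg := A
      d := 0
      d_mem := fun _ => Submodule.zero_mem _
      d_d := fun _ => rfl
      leibniz := fun _ _ => by simp }
  map f := ⟨f, fun _ => map_zero f.toAlgHom⟩

/-! ### Cohomology and quasi-isomorphisms -/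

/-- The coboundaries, as a submodule of the cocycles. -/
def DGAlg.coboundaries (A : DGAlg.{u}) : Submodule ℚ (LinearMap.ker A.d) :=
  (LinearMap.range A.d).comap (LinearMap.ker A.d).subtype

/-- The (total) cohomology `ker d / im d`. -/
abbrev DGAlg.Cohomology (A : DGAlg.{u}) : Type u := LinearMap.ker A.d ⧸ A.coboundaries

/-- The map on cocycles induced by a morphism. -/
def DGAlg.Hom.mapCocycles {A B : DGAlg.{u}} (f : DGAlg.Hom A B) :
    LinearMap.ker A.d →ₗ[ℚ] LinearMap.ker B.d :=
  f.toAlgHom.toLinearMap.restrict fun x hx => by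
    have hx' : A.d x = 0 := hx
    have h := f.map_d x
    rw [hx', map_zero] at h
    exact h.symm

/-- The map on cohomology induced by a morphism. -/
def DGAlg.Hom.mapCohomology {A B : DGAlg.{u}} (f : DGAlg.Hom A B) :
    A.Cohomology →ₗ[ℚ] B.Cohomology :=
  Submodule.mapQ _ _ f.mapCocycles (by
    rintro x ⟨y, hy⟩
    exact ⟨f.toAlgHom y, by
      rw [← f.map_d, hy]
      rfl⟩)

/-! ### Diagrams of algebras over the orbit category -/

/-- A diagram of graded commutative algebras. -/
abbrev GADiagram (G : Type v) [Group G] := Orbit G ⥤ GrAlg.{u}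

/-- A diagram of differential graded algebras. -/
abbrev DGADiagram (G : Type v) [Group G] := Orbit G ⥤ DGAlg.{u}

variable {G : Type v} [Group G]

/-- The component at the orbit `c` of a map from a system of vector spaces to a diagram of
algebras, as a linear map. -/
def level {V : VectSystem.{u} G} {U : DGADiagram.{u} G} (f : V ⟶ U ⋙ DGAlg.vect) (c : Orbit G) :
    V.obj c →ₗ[ℚ] U.obj c :=
  (f.app c).hom

/-- A morphism of diagrams is a quasi-isomorphism if it induces an isomorphism in cohomology at
each orbit `G/H`. (A bijection in total cohomology is a bijection in each degree, since
morphisms preserve degrees.) -/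
def IsQuasiIso {U W : DGADiagram.{u} G} (f : U ⟶ W) : Prop :=
  ∀ c : Orbit G, Function.Bijective (DGAlg.Hom.mapCohomology (f.app c))

/-- A monomorphism is essential if a morphism out of its target is a monomorphism as soon as its
restriction is. -/
def IsEssentialMono {C : Type*} [Category* C] {X Y : C} (f : X ⟶ Y) : Prop :=
  Mono f ∧ ∀ ⦃Z : C⦄ (g : Y ⟶ Z), Mono (f ≫ g) → Mono g

/-- An injective resolution `V → V₀ → V₁ → ⋯` is minimal if each `Vᵢ` is an injective envelope of
the kernel of `wᵢ : Vᵢ → Vᵢ₊₁`; by exactness this kernel is `V` for `i = 0`, and the cokernel of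
the preceding map `wᵢ₋₂` (of `V → V₀` if `i = 1`) for `i ≥ 1`. -/
def IsMinimalResolution {V : VectSystem.{u} G} (R : InjectiveResolution V) : Prop :=
  ∀ i : ℕ, IsEssentialMono (kernel.ι (R.cocomplex.d i (i + 1)))

/-- `ElementaryExtension n ι V` exhibits `ι : U ⟶ W` as an elementary extension `U ⟶ U^α(V)` of `U`
by the system of vector spaces `V`, placed in degree `n`. The attaching map `α : V → Zⁿ⁺¹(U)` is
the composite of `V → V₀` with `attach 0`; it takes values in the cocycles because of
`attach_comm`. -/
structure ElementaryExtension (n : ℕ) {U W : DGADiagram.{u} G} (ι : U ⟶ W)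
    (V : VectSystem.{u} G) where
  /-- the minimal injective resolution `V → V₀ → V₁ → ⋯` -/
  res : InjectiveResolution V
  res_minimal : IsMinimalResolution res
  /-- the maps `αᵢ : Vᵢ → Uⁿ⁺ⁱ⁺¹` extending the attaching map `α` -/
  attach : ∀ i : ℕ, res.cocomplex.X i ⟶ U ⋙ DGAlg.vect
  attach_mem : ∀ (i : ℕ) (c : Orbit G) (x : (res.cocomplex.X i).obj c),
    level (attach i) c x ∈ (U.obj c).grade (n + i + 1)
  attach_comm : ∀ (i : ℕ) (c : Orbit G) (x : (res.cocomplex.X i).obj c),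
    (U.obj c).d (level (attach i) c x) =
      level (attach (i + 1)) c ((res.cocomplex.d i (i + 1)).app c x)
  /-- the inclusion of the generators `Vᵢ → Wⁿ⁺ⁱ` -/
  gen : ∀ i : ℕ, res.cocomplex.X i ⟶ W ⋙ DGAlg.vect
  gen_mem : ∀ (i : ℕ) (c : Orbit G) (x : (res.cocomplex.X i).obj c),
    level (gen i) c x ∈ (W.obj c).grade (n + i)
  /-- on generators `d = (-1)ⁱ αᵢ + wᵢ` -/
  d_gen : ∀ (i : ℕ) (c : Orbit G) (x : (res.cocomplex.X i).obj c),
    (W.obj c).d (level (gen i) c x) =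
      (-1 : ℚ) ^ i • (ι.app c).toAlgHom (level (attach i) c x) +
        level (gen (i + 1)) c ((res.cocomplex.d i (i + 1)).app c x)
  /-- At each orbit, `W = U ⊗ (⨂ᵢ ℚ(Vᵢ))` as a graded algebra, where `ℚ(Vᵢ)` is the free graded
  commutative algebra on `Vᵢ` in degree `n + i`. Tensor products being the coproducts of graded
  commutative algebras, this says that `W` is the free graded commutative algebra under `U` on
  the generators `Vᵢ`. -/
  free : ∀ (c : Orbit G) (B : GrAlg.{u}) (f : GrAlg.Hom (U.obj c).toGrAlg B)
    (g : ∀ i : ℕ, (res.cocomplex.X i).obj c →ₗ[ℚ] B), (∀ i x, g i x ∈ B.grade (n + i)) →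
    ∃! F : GrAlg.Hom (W.obj c).toGrAlg B,
      (∀ a : U.obj c, F.toAlgHom ((ι.app c).toAlgHom a) = f.toAlgHom a) ∧
      ∀ i x, F.toAlgHom (level (gen i) c x) = g i x

/-- A minimal system of differential graded algebras `M = ⋃ₙ Mₙ`, together with its filtration:
`M₀ = M₁ = ℚ`, and for `n ≥ 2` the stage `Mₙ` is an elementary extension of `Mₙ₋₁` by a system of
vector spaces `vec n` in degree `n`. -/
structure MinimalSystem (G : Type v) [Group G] where
  /-- the union `M` -/
  total : DGADiagram.{u} G
  total_injective : Injective (total ⋙ DGAlg.vect)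
  /-- the stage `Mₙ` -/
  stage : ℕ → DGADiagram.{u} G
  /-- the map `Mₙ → Mₙ₊₁` -/
  incl : ∀ n : ℕ, stage n ⟶ stage (n + 1)
  /-- the inclusion `Mₙ → M` -/
  toTotal : ∀ n : ℕ, stage n ⟶ total
  incl_toTotal : ∀ n : ℕ, incl n ≫ toTotal (n + 1) = toTotal n
  toTotal_injective : ∀ (n : ℕ) (c : Orbit G),
    Function.Injective ((toTotal n).app c).toAlgHom
  exhausts : ∀ (c : Orbit G) (x : total.obj c),
    ∃ (n : ℕ) (y : (stage n).obj c), ((toTotal n).app c).toAlgHom y = x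
  stage_zero : ∀ c : Orbit G, Function.Bijective (algebraMap ℚ ((stage 0).obj c))
  stage_one : ∀ c : Orbit G, Function.Bijective (algebraMap ℚ ((stage 1).obj c))
  /-- the system of vector spaces added at the `n`-th stage (meaningful for `n ≥ 2`) -/
  vec : ℕ → VectSystem.{u} G
  /-- `Mₙ₊₁` is an elementary extension of `Mₙ` by `vec (n + 1)` in degree `n + 1` -/
  ext : ∀ n : ℕ, 1 ≤ n → ElementaryExtension (n + 1) (incl n) (vec (n + 1))

/-- A minimal model of a diagram of differential graded algebras: a minimal system with a
quasi-isomorphism to the diagram. -/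
structure MinimalModel (U : DGADiagram.{u} G) extends MinimalSystem.{u} G where
  /-- the quasi-isomorphism -/
  ρ : total ⟶ U
  quasiIso : IsQuasiIso ρ

/-- For a minimal model of a diagram of graded algebras `A` (with zero differential), the system of
vector spaces `V` with `Mₙ = Mₙ₋₁(V)` is the `n`-th stage associated system of vector spaces of
`A` (for `n ≥ 2`). -/
abbrev MinimalModel.associatedSystem {A : GADiagram.{u} G} (M : MinimalModel (A ⋙ GrAlg.zeroD))
    (n : ℕ) : VectSystem.{u} G := M.vec n

/-- A diagram of graded algebras is injective if its underlying system of rational vector spaces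
is. -/
abbrev GAInjective (A : GADiagram.{u} G) : Prop := Injective (A ⋙ GrAlg.vect)

end EquivMin

universe w

namespace EquivMin

/-! ### Graded subalgebras and square-zero extensions -/

/-! A group of prime order has only two orbits, the free one and the point, and injectivity of a
system `V` is equivalent to surjectivity of `V(G/e) → V(G/G)`. Necessity (`surjective_map_of_epi`)
holds because the projection of orbits is an epimorphism, so precomposition with it embeds one free
system in another. Sufficiency (`injective_of_surjective`) comes from extending maps orbit by orbit
and averaging over the group, which is possible over ℚ.

It remains to carry surjectivity from the algebras to the new generators
(`MinimalModel.surjective_vec_map`). Let `v` lie in `V(G/G)` and let `s` be its generator, of degree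
n. The attaching map sends `v` to degree n+1 of the previous stage, which vanishes, so `s` is a
cocycle. Its class in the cohomology algebra lifts to the free orbit and is represented there by a
cocycle `z` of degree n. This `z` lies in the n-th stage, so it is `b` plus a generator `x` of `V₀`,
with `b` from the previous stage. From `dz = 0` one gets `w₀ x = 0`, so `x` comes from some `u` in
`V(G/e)`. At the point, the image of `z` minus `s` is a coboundary of an element of degree n-1,
which lies in the previous stage; hence the generators of the image of `u` and of `v` agree modulo
the previous stage, and `u` maps to `v`.

The two facts about free extensions behind this follow from the universal property alone. Mapping
into a graded subalgebra bounds the extension in degrees at most n (`IsFreeExtension.grade_subset`);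
mapping into a square-zero extension shows that generators are independent of the base
(`IsFreeExtension.eq_zero_of_gen_eq`). -/

theorem GrAlg.Hom.map_proj {A B : GrAlg.{u}} (f : GrAlg.Hom A B) (i : ℕ) (x : A) :
    f.toAlgHom (GradedAlgebra.proj A.grade i x) = GradedAlgebra.proj B.grade i (f.toAlgHom x) := by
  induction x using DirectSum.Decomposition.inductionOn A.grade with
  | zero => simp
  | @homogeneous j m =>
    simp only [GradedAlgebra.proj_apply]
    rcases eq_or_ne j i with rfl | h
    · rw [DirectSum.decompose_of_mem_same _ m.2, DirectSum.decompose_of_mem_same _ (f.map_mem m.2)]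
    · rw [DirectSum.decompose_of_mem_ne _ m.2 h, DirectSum.decompose_of_mem_ne _ (f.map_mem m.2) h,
        map_zero]
  | add a b ha hb => simp only [map_add, ha, hb]

theorem DGAlg.d_proj (A : DGAlg.{u}) (i : ℕ) (x : A) :
    A.d (GradedAlgebra.proj A.grade i x) = GradedAlgebra.proj A.grade (i + 1) (A.d x) := by
  induction x using DirectSum.Decomposition.inductionOn A.grade with
  | zero => simp
  | @homogeneous j m =>
    simp only [GradedAlgebra.proj_apply]
    rcases eq_or_ne j i with rfl | h
    · rw [DirectSum.decompose_of_mem_same _ m.2, DirectSum.decompose_of_mem_same _ (A.d_mem m.2)]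
    · rw [DirectSum.decompose_of_mem_ne _ m.2 h,
        DirectSum.decompose_of_mem_ne _ (A.d_mem m.2) (by omega), map_zero]
  | add a b ha hb => simp only [map_add, ha, hb]

theorem GrAlg.proj_mem (A : GrAlg.{u}) (i : ℕ) (x : A) :
    GradedAlgebra.proj A.grade i x ∈ A.grade i := by
  rw [GradedAlgebra.proj_apply]; exact SetLike.coe_mem _

theorem GrAlg.proj_of_mem (A : GrAlg.{u}) {i : ℕ} {x : A} (hx : x ∈ A.grade i) :
    GradedAlgebra.proj A.grade i x = x := by
  rw [GradedAlgebra.proj_apply, DirectSum.decompose_of_mem_same _ hx]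

/-- The subalgebra of elements whose homogeneous components lie in a multiplicatively closed family
of subspaces. -/
def GrAlg.subalgebraOf (A : GrAlg.{u}) (T : ℕ → Submodule ℚ A) (h1 : (1 : A) ∈ T 0)
    (hmul : ∀ {i j : ℕ} {x y : A}, x ∈ T i → y ∈ T j → x * y ∈ T (i + j)) : Subalgebra ℚ A :=
  Submodule.toSubalgebra (⨅ i, (T i).comap (GradedAlgebra.proj A.grade i))
    (by
      rw [Submodule.mem_iInf]
      intro i
      rw [Submodule.mem_comap, GradedAlgebra.proj_apply]
      rcases eq_or_ne 0 i with rfl | h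
      · rwa [DirectSum.decompose_of_mem_same _ SetLike.GradedOne.one_mem]
      · rw [DirectSum.decompose_of_mem_ne _ SetLike.GradedOne.one_mem h]
        exact zero_mem _)
    (by
      intro x y hx hy
      simp only [Submodule.mem_iInf, Submodule.mem_comap, GradedAlgebra.proj_apply] at hx hy ⊢
      intro k
      classical
      rw [DirectSum.decompose_mul, DirectSum.coe_mul_apply]
      refine sum_mem fun ij hij => ?_
      rw [← (Finset.mem_filter.mp hij).2]
      exact hmul (hx _) (hy _))

theorem GrAlg.mem_subalgebraOf {A : GrAlg.{u}} {T : ℕ → Submodule ℚ A} {h1 : (1 : A) ∈ T 0}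
    {hmul : ∀ {i j : ℕ} {x y : A}, x ∈ T i → y ∈ T j → x * y ∈ T (i + j)} {x : A} :
    x ∈ A.subalgebraOf T h1 hmul ↔ ∀ i, GradedAlgebra.proj A.grade i x ∈ T i := by
  simp [GrAlg.subalgebraOf]

theorem GrAlg.mem_subalgebraOf_of_mem {A : GrAlg.{u}} {T : ℕ → Submodule ℚ A} {h1 : (1 : A) ∈ T 0}
    {hmul : ∀ {i j : ℕ} {x y : A}, x ∈ T i → y ∈ T j → x * y ∈ T (i + j)} {i : ℕ} {x : A}
    (hx : x ∈ A.grade i) (hxT : x ∈ T i) : x ∈ A.subalgebraOf T h1 hmul := by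
  rw [GrAlg.mem_subalgebraOf]
  intro j
  rw [GradedAlgebra.proj_apply]
  rcases eq_or_ne i j with rfl | h
  · rwa [DirectSum.decompose_of_mem_same _ hx]
  · rw [DirectSum.decompose_of_mem_ne _ hx h]
    exact zero_mem _

/-- A subalgebra containing the homogeneous components of its elements is a graded algebra. -/
noncomputable def GrAlg.ofSubalgebra (A : GrAlg.{u}) (S : Subalgebra ℚ A)
    (hS : ∀ x ∈ S, ∀ i, GradedAlgebra.proj A.grade i x ∈ S) : GrAlg.{u} where
  carrier := S
  grade i := (A.grade i).comap S.val.toLinearMap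
  gradedAlgebra :=
    { one_mem := SetLike.GradedOne.one_mem (A := A.grade)
      mul_mem := fun _ _ _ _ hx hy => SetLike.GradedMul.mul_mem (A := A.grade) hx hy
      toDecomposition := by
        classical
        refine DirectSum.IsInternal.chooseDecomposition _ ?_
        rw [DirectSum.isInternal_submodule_iff_iSupIndep_and_iSup_eq_top]
        constructor
        · have h := (DirectSum.Decomposition.isInternal A.grade).submodule_iSupIndep
          rw [iSupIndep_def] at h ⊢
          intro i
          rw [Submodule.disjoint_def]
          intro x hx hx'
          have := Submodule.disjoint_def.mp (h i) x.1 hx (by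
            have hm := Submodule.mem_map_of_mem (f := S.val.toLinearMap) hx'
            simp only [Submodule.map_iSup] at hm
            have hle : (⨆ j, ⨆ (_ : j ≠ i), ((A.grade j).comap S.val.toLinearMap).map
                S.val.toLinearMap) ≤ ⨆ j, ⨆ (_ : j ≠ i), A.grade j :=
              iSup₂_mono fun j _ => Submodule.map_comap_le _ _
            exact hle hm)
          exact Subtype.ext this
        · rw [eq_top_iff]
          intro x _
          have hx : x = ∑ i ∈ (DirectSum.decompose A.grade x.1).support,
              (⟨GradedAlgebra.proj A.grade i x.1, hS _ x.2 i⟩ : S) := by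
            apply Subtype.ext
            rw [AddSubmonoidClass.coe_finsetSum]
            exact (DirectSum.sum_support_decompose A.grade x.1).symm
          rw [hx]
          refine sum_mem fun i _ => Submodule.mem_iSup_of_mem i ?_
          exact A.proj_mem i x.1 }
  graded_comm := fun hx hy => Subtype.ext (A.graded_comm hx hy)

/-- The square-zero extension of `ℚ` by a vector space placed in a positive degree `m`. -/
noncomputable def GrAlg.sqZero (N : Type u) [AddCommGroup N] [Module ℚ N] [Module ℚᵐᵒᵖ N]
    [IsCentralScalar ℚ N] (m : ℕ) (hm : 0 < m) : GrAlg.{u} where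
  carrier := TrivSqZeroExt ℚ N
  grade i :=
    { carrier := {x | (i ≠ 0 → x.fst = 0) ∧ (i ≠ m → x.snd = 0)}
      add_mem' := fun hx hy => ⟨fun h => by simp [hx.1 h, hy.1 h], fun h => by simp [hx.2 h, hy.2 h]⟩
      zero_mem' := ⟨fun _ => rfl, fun _ => rfl⟩
      smul_mem' := fun q x hx => ⟨fun h => by simp [hx.1 h], fun h => by simp [hx.2 h]⟩ }
  gradedAlgebra :=
    { one_mem := ⟨fun h => absurd rfl h, fun _ => rfl⟩
      mul_mem := by
        intro i j x y hx hy
        constructor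
        · intro h
          rcases Nat.eq_zero_or_pos i with rfl | hi
          · simp [hy.1 (by omega)]
          · simp [hx.1 (by omega)]
        · intro h
          have e1 : x.fst • y.snd = 0 := by
            rcases Nat.eq_zero_or_pos i with rfl | hi
            · simp [hy.2 (by omega)]
            · simp [hx.1 (by omega)]
          have e2 : y.fst • x.snd = 0 := by
            rcases Nat.eq_zero_or_pos j with rfl | hi
            · simp [hx.2 (by omega)]
            · simp [hy.1 (by omega)]
          simp [e1, e2]
      toDecomposition := by
        classical
        refine DirectSum.IsInternal.chooseDecomposition _ ?_
        rw [DirectSum.isInternal_submodule_iff_iSupIndep_and_iSup_eq_top]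
        constructor
        · rw [iSupIndep_def]
          intro i
          rw [Submodule.disjoint_def]
          intro x hx hx'
          have key : (i = 0 → x.fst = 0) ∧ (i = m → x.snd = 0) := by
            constructor
            · rintro rfl
              suffices h : (⨆ j, ⨆ (_ : j ≠ 0), _) ≤
                  LinearMap.ker (TrivSqZeroExt.fstHom ℚ ℚ N).toLinearMap from h hx'
              exact iSup₂_le fun j hj y hy => hy.1 hj
            · rintro rfl
              suffices h : (⨆ j, ⨆ (_ : j ≠ i), _) ≤
                  LinearMap.ker (TrivSqZeroExt.sndHom ℚ N) from h hx'
              exact iSup₂_le fun j hj y hy => hy.2 hj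
          exact TrivSqZeroExt.ext ((em (i = 0)).elim key.1 hx.1) ((em (i = m)).elim key.2 hx.2)
        · rw [eq_top_iff]
          intro x _
          rw [← TrivSqZeroExt.inl_fst_add_inr_snd_eq x]
          refine add_mem (Submodule.mem_iSup_of_mem 0 ?_) (Submodule.mem_iSup_of_mem m ?_)
          · exact ⟨fun h => absurd rfl h, fun _ => rfl⟩
          · exact ⟨fun _ => rfl, fun h => absurd rfl h⟩ }
  graded_comm := by
    intro i j x y hx hy
    rcases Nat.eq_zero_or_pos i with rfl | hi
    · simp [mul_comm]
    · rcases Nat.eq_zero_or_pos j with rfl | hj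
      · simp [mul_comm]
      -- In positive degrees the scalar parts vanish, so both products are zero and the sign is
      -- irrelevant.
      · have h1 := hx.1 hi.ne'
        have h2 := hy.1 hj.ne'
        have e : ∀ a b : TrivSqZeroExt ℚ N, a.fst = 0 → b.fst = 0 → a * b = 0 := fun a b ha hb =>
          TrivSqZeroExt.ext (by simp [ha]) (by simp [ha, hb])
        rw [e x y h1 h2, e y x h2 h1, smul_zero]

/-- A graded algebra is connected if it is non-zero and consists of scalars in degree zero. -/
structure GrAlg.IsConnected (A : GrAlg.{u}) : Prop where
  nontrivial : Nontrivial A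
  scalar : ∀ x ∈ A.grade 0, ∃ q : ℚ, x = algebraMap ℚ A q

/-- A connected graded algebra has an augmentation. -/
theorem GrAlg.IsConnected.exists_augmentation {A : GrAlg.{u}} (hA : A.IsConnected) :
    ∃ ε : A →ₐ[ℚ] ℚ, ∀ i x, x ∈ A.grade i → i ≠ 0 → ε x = 0 := by
  have := hA.nontrivial
  have inj : Function.Injective (algebraMap ℚ A) := (algebraMap ℚ A).injective
  -- The augmentation reads the degree-zero component as a scalar; its algebraic laws are checked
  -- after the injection of ℚ into `A`, where they are those of `GradedRing.projZeroRingHom`.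
  choose e he using fun x : A => hA.scalar _ (A.proj_mem 0 x)
  have he' : ∀ x, GradedRing.projZeroRingHom A.grade x = algebraMap ℚ A (e x) := he
  refine ⟨AlgHom.ofLinearMap ⟨⟨e, fun x y => inj ?_⟩, fun q x => inj ?_⟩ (inj ?_)
    (fun x y => inj ?_), fun i x hx hi => inj ?_⟩
  · rw [map_add, ← he, ← he, ← he, map_add]
  · change algebraMap ℚ A (e (q • x)) = algebraMap ℚ A (q • e x)
    rw [← he, map_smul, he, smul_eq_mul, map_mul, Algebra.smul_def]
  · change algebraMap ℚ A (e 1) = _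
    rw [← he', map_one, map_one]
  · change algebraMap ℚ A (e (x * y)) = algebraMap ℚ A (e x * e y)
    rw [map_mul, ← he', ← he', ← he', map_mul]
  · change algebraMap ℚ A (e x) = _
    rw [← he, GradedAlgebra.proj_apply, DirectSum.decompose_of_mem_ne _ hx hi, map_zero]

/-! ### Free extensions of connected graded algebras -/

section FreeExtension

variable {U W : GrAlg.{u}} {ι : GrAlg.Hom U W} {n : ℕ} {X : ℕ → Type u}
  [∀ i, AddCommGroup (X i)] [∀ i, Module ℚ (X i)] {gen : ∀ i, X i →ₗ[ℚ] W}

/-- `W` is the free graded commutative algebra under `U` on generators `X i` in degree `n + i`. -/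
def IsFreeExtension (ι : GrAlg.Hom U W) (n : ℕ) (gen : ∀ i, X i →ₗ[ℚ] W) : Prop :=
  ∀ (B : GrAlg.{u}) (f : GrAlg.Hom U B) (g : ∀ i : ℕ, X i →ₗ[ℚ] B),
    (∀ i x, g i x ∈ B.grade (n + i)) →
    ∃! F : GrAlg.Hom W B, (∀ a : U, F.toAlgHom (ι.toAlgHom a) = f.toAlgHom a) ∧
      ∀ i x, F.toAlgHom (gen i x) = g i x

/-- The elements with components in `T` form a graded subalgebra containing the base and the
generators. The universal property gives a map from `W` to it, and by uniqueness the composite with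
the inclusion is the identity, so the subalgebra is everything. -/
theorem IsFreeExtension.grade_le (h : IsFreeExtension ι n gen)
    (gen_mem : ∀ i x, gen i x ∈ W.grade (n + i)) (T : ℕ → Submodule ℚ W) (h1 : (1 : W) ∈ T 0)
    (hmul : ∀ {i j : ℕ} {x y : W}, x ∈ T i → y ∈ T j → x * y ∈ T (i + j))
    (hU : ∀ i x, x ∈ U.grade i → ι.toAlgHom x ∈ T i) (hgen : ∀ i x, gen i x ∈ T (n + i))
    (i : ℕ) : W.grade i ≤ T i := by
  have hcomp : ∀ x ∈ W.subalgebraOf T h1 hmul, ∀ i,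
      GradedAlgebra.proj W.grade i x ∈ W.subalgebraOf T h1 hmul := fun x hx i =>
    GrAlg.mem_subalgebraOf_of_mem (W.proj_mem i x) (GrAlg.mem_subalgebraOf.mp hx i)
  have hιS : ∀ x, ι.toAlgHom x ∈ W.subalgebraOf T h1 hmul := fun x =>
    GrAlg.mem_subalgebraOf.mpr fun i => by
      rw [← ι.map_proj]
      exact hU i _ (U.proj_mem i x)
  have hgS : ∀ i x, gen i x ∈ W.subalgebraOf T h1 hmul := fun i x =>
    GrAlg.mem_subalgebraOf_of_mem (gen_mem i x) (hgen i x)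
  let g : ∀ i, X i →ₗ[ℚ] W.ofSubalgebra (W.subalgebraOf T h1 hmul) hcomp := fun i =>
    (gen i).codRestrict (Subalgebra.toSubmodule (W.subalgebraOf T h1 hmul)) (hgS i)
  obtain ⟨F, ⟨hF1, hF2⟩, -⟩ := h (W.ofSubalgebra (W.subalgebraOf T h1 hmul) hcomp)
    ⟨ι.toAlgHom.codRestrict _ hιS, fun hx => ι.map_mem hx⟩ g (fun i x => gen_mem i x)
  have hFW : (⟨(W.subalgebraOf T h1 hmul).val.comp F.toAlgHom, fun hx => F.map_mem hx⟩ :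
      GrAlg.Hom W W) = ⟨AlgHom.id ℚ W, fun hx => hx⟩ :=
    (h W ι gen gen_mem).unique ⟨fun a => congrArg Subtype.val (hF1 a),
      fun i x => congrArg Subtype.val (hF2 i x)⟩ ⟨fun _ => rfl, fun _ _ => rfl⟩
  intro x hx
  have hxS : (F.toAlgHom x : W.subalgebraOf T h1 hmul).1 = x :=
    DFunLike.congr_fun (congrArg GrAlg.Hom.toAlgHom hFW) x
  have := GrAlg.mem_subalgebraOf.mp (F.toAlgHom x : W.subalgebraOf T h1 hmul).2 i
  rwa [hxS, W.proj_of_mem hx] at this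

/-- The bounding family is multiplicatively closed because degree zero consists of scalars: a
product of two factors of positive degree landing in degree at most `n` has both factors below `n`,
hence in the image of `U`. Above `n` there is no constraint. -/
theorem IsFreeExtension.grade_subset (h : IsFreeExtension ι n gen) (hn : 0 < n)
    (hU : U.IsConnected) (gen_mem : ∀ i x, gen i x ∈ W.grade (n + i)) (k : ℕ) :
    W.grade k ≤ (if k < n then (U.grade k).map ι.toAlgHom.toLinearMap else
      if k = n then (U.grade k).map ι.toAlgHom.toLinearMap ⊔ LinearMap.range (gen 0)
      else W.grade k) := by
  have hmapW : ∀ k, (U.grade k).map ι.toAlgHom.toLinearMap ≤ W.grade k := by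
    rintro k _ ⟨x, hx, rfl⟩
    exact ι.map_mem hx
  have hgW : LinearMap.range (gen 0) ≤ W.grade n := by
    rintro _ ⟨x, rfl⟩
    exact gen_mem 0 x
  refine h.grade_le gen_mem (fun k => if k < n then (U.grade k).map ι.toAlgHom.toLinearMap else
      if k = n then (U.grade k).map ι.toAlgHom.toLinearMap ⊔ LinearMap.range (gen 0)
      else W.grade k) ?_ ?_ ?_ ?_ k
  · rw [if_pos hn]
    exact ⟨1, SetLike.GradedOne.one_mem, map_one ι.toAlgHom⟩
  · have hW : ∀ k, (if k < n then (U.grade k).map ι.toAlgHom.toLinearMap else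
      if k = n then (U.grade k).map ι.toAlgHom.toLinearMap ⊔ LinearMap.range (gen 0)
      else W.grade k) ≤ W.grade k := by
      intro k
      split_ifs with h1 h2
      · exact hmapW k
      · subst h2; exact sup_le (hmapW k) hgW
      · exact le_rfl
    have hscal : ∀ y ∈ (U.grade 0).map ι.toAlgHom.toLinearMap,
        ∃ q : ℚ, y = algebraMap ℚ W q := by
      rintro _ ⟨x, hx, rfl⟩
      obtain ⟨q, rfl⟩ := hU.scalar x hx
      exact ⟨q, ι.toAlgHom.commutes q⟩
    intro i j x y hx hy
    by_cases hi : i = 0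
    · subst hi
      rw [if_pos hn] at hx
      obtain ⟨q, rfl⟩ := hscal x hx
      rw [← Algebra.smul_def, zero_add]
      exact Submodule.smul_mem _ _ hy
    by_cases hj : j = 0
    · subst hj
      rw [if_pos hn] at hy
      obtain ⟨q, rfl⟩ := hscal y hy
      rw [← Algebra.commutes, ← Algebra.smul_def]
      exact Submodule.smul_mem _ _ hx
    by_cases hij : i + j ≤ n
    · rw [if_pos (by omega)] at hx hy
      obtain ⟨x, hx, rfl⟩ := hx
      obtain ⟨y, hy, rfl⟩ := hy
      have hxy : ι.toAlgHom.toLinearMap x * ι.toAlgHom.toLinearMap y ∈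
          (U.grade (i + j)).map ι.toAlgHom.toLinearMap :=
        ⟨x * y, SetLike.GradedMul.mul_mem hx hy, map_mul ι.toAlgHom x y⟩
      split_ifs
      · exact hxy
      · exact Submodule.mem_sup_left hxy
      · exact SetLike.GradedMul.mul_mem (hmapW _ ⟨x, hx, rfl⟩) (hmapW _ ⟨y, hy, rfl⟩)
    · rw [if_neg (by omega), if_neg (by omega)]
      exact SetLike.GradedMul.mul_mem (hW _ hx) (hW _ hy)
  · intro i x hx
    split_ifs
    · exact ⟨x, hx, rfl⟩
    · exact Submodule.mem_sup_left ⟨x, hx, rfl⟩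
    · exact ι.map_mem hx
  · intro i x
    rcases Nat.eq_zero_or_pos i with rfl | hi
    · rw [if_neg (by omega), if_pos (by omega)]
      exact Submodule.mem_sup_right ⟨x, rfl⟩
    · rw [if_neg (by omega), if_neg (by omega)]
      exact gen_mem i x

/-- Below the degree of the generators nothing is added. -/
theorem IsFreeExtension.exists_of_lt (h : IsFreeExtension ι n gen) (hU : U.IsConnected)
    (gen_mem : ∀ i x, gen i x ∈ W.grade (n + i)) {k : ℕ} (hk : k < n) {w : W}
    (hw : w ∈ W.grade k) : ∃ a ∈ U.grade k, ι.toAlgHom a = w := by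
  have := h.grade_subset (by omega) hU gen_mem k hw
  rw [if_pos hk] at this
  exact this

/-- In the degree of the generators only the generators themselves are added. -/
theorem IsFreeExtension.exists_of_mem_grade (h : IsFreeExtension ι n gen) (hn : 0 < n)
    (hU : U.IsConnected) (gen_mem : ∀ i x, gen i x ∈ W.grade (n + i)) {w : W}
    (hw : w ∈ W.grade n) : ∃ a ∈ U.grade n, ∃ x, w = ι.toAlgHom a + gen 0 x := by
  have := h.grade_subset hn hU gen_mem n hw
  rw [if_neg (lt_irrefl n), if_pos rfl] at this
  obtain ⟨_, ⟨a, ha, rfl⟩, _, ⟨x, rfl⟩, rfl⟩ := Submodule.mem_sup.mp this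
  exact ⟨a, ha, x, rfl⟩

/-- The generators are linearly independent of `U`. -/
theorem IsFreeExtension.eq_zero_of_gen_eq (h : IsFreeExtension ι n gen) (hn : 0 < n)
    (hU : U.IsConnected) {i : ℕ} {a : U} {x : X i}
    (hx : gen i x = ι.toAlgHom a) : x = 0 := by
  classical
  obtain ⟨ε, hε⟩ := hU.exists_augmentation
  -- `TrivSqZeroExt` needs a right action; the left one is reused.
  let : Module ℚᵐᵒᵖ (X i) := Module.compHom _ ((RingHom.id ℚ).fromOpposite mul_comm)
  have : IsCentralScalar ℚ (X i) := ⟨fun _ _ => rfl⟩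
  -- The test algebra is ℚ ⊕ `X i`: the base goes to ℚ by the augmentation, `X i` goes identically
  -- to the square-zero part, and all other generators go to zero. The square-zero component then
  -- separates `gen i x` from the base.
  let f : GrAlg.Hom U (GrAlg.sqZero (X i) (n + i) (by omega)) :=
    ⟨(TrivSqZeroExt.inlAlgHom ℚ ℚ (X i)).comp ε, fun {j y} hy => ⟨fun hj => hε j y hy hj,
      fun _ => rfl⟩⟩
  let g : ∀ j, X j →ₗ[ℚ] GrAlg.sqZero (X i) (n + i) (by omega) := fun j =>
    if hj : i = j then hj ▸ TrivSqZeroExt.inrHom ℚ (X i) else 0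
  obtain ⟨F, ⟨hF1, hF2⟩, -⟩ := h _ f g (fun j y => by
    by_cases hj : i = j
    · subst hj
      simp only [g, dif_pos]
      exact ⟨fun _ => rfl, fun h => absurd rfl h⟩
    · simp only [g, dif_neg hj]
      exact zero_mem _)
  have e1 := hF2 i x
  rw [hx, hF1] at e1
  have e2 : f.toAlgHom a = TrivSqZeroExt.inl (ε a) := rfl
  have e3 : g i x = TrivSqZeroExt.inr x := by simp only [g, dif_pos]; rfl
  rw [e2, e3] at e1
  exact (congrArg TrivSqZeroExt.snd e1).symm

end FreeExtension

/-! ### Injective systems of vector spaces -/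

section Epi

variable {C : Type*} [Category.{v} C]

/-- The free system of rational vector spaces on the functor corepresented by `c`. -/
noncomputable def freeCoyoneda (c : C) : C ⥤ ModuleCat.{max w v} ℚ where
  obj d := ModuleCat.of ℚ (ULift.{w} (c ⟶ d) →₀ ℚ)
  map f := ModuleCat.ofHom (Finsupp.lmapDomain ℚ ℚ fun h => ULift.up (h.down ≫ f))
  map_id d := by
    ext
    simp
  map_comp f g := by
    ext
    simp [← Finsupp.mapDomain_comp, Function.comp_def]

/-- The morphism from a free system given by an element. -/
noncomputable def freeCoyonedaDesc {F : C ⥤ ModuleCat.{max w v} ℚ} {c : C} (a : F.obj c) :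
    freeCoyoneda.{v, w} c ⟶ F where
  app d := ModuleCat.ofHom (Finsupp.linearCombination ℚ fun h => F.map h.down a)
  naturality d e f := by
    apply ModuleCat.hom_ext
    apply Finsupp.lhom_ext
    intro h q
    simp [freeCoyoneda]

/-- Precomposition as a morphism of free systems. -/
noncomputable def freeCoyonedaMap {c c' : C} (e : c ⟶ c') :
    freeCoyoneda.{v, w} c' ⟶ freeCoyoneda.{v, w} c where
  app d := ModuleCat.ofHom (Finsupp.lmapDomain ℚ ℚ fun h => ULift.up (e ≫ h.down))
  naturality d d' f := by
    apply ModuleCat.hom_ext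
    apply Finsupp.lhom_ext
    intro h q
    change Finsupp.mapDomain _ (Finsupp.mapDomain _ _) = Finsupp.mapDomain _ (Finsupp.mapDomain _ _)
    simp only [Finsupp.mapDomain_single, Category.assoc]

/-- The generator of the free system at a morphism. -/
noncomputable def freeCoyonedaMk {c d : C} (h : c ⟶ d) : (freeCoyoneda.{v, w} c).obj d :=
  show ULift.{w} (c ⟶ d) →₀ ℚ from Finsupp.single (ULift.up h) 1

theorem freeCoyonedaDesc_mk {F : C ⥤ ModuleCat.{max w v} ℚ} {c d : C} (a : F.obj c) (h : c ⟶ d) :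
    (freeCoyonedaDesc.{v, w} a).app d (freeCoyonedaMk h) = F.map h a := by
  change Finsupp.linearCombination ℚ (fun h : ULift.{w} (c ⟶ d) => F.map h.down a)
    (Finsupp.single (ULift.up h) 1) = _
  simp

theorem freeCoyonedaMap_mk {c c' d : C} (e : c ⟶ c') (h : c' ⟶ d) :
    (freeCoyonedaMap.{v, w} e).app d (freeCoyonedaMk h) = freeCoyonedaMk (e ≫ h) :=
  Finsupp.mapDomain_single

theorem freeCoyoneda_map_mk {c d d' : C} (h : c ⟶ d) (f : d ⟶ d') :
    (freeCoyoneda.{v, w} c).map f (freeCoyonedaMk h) = freeCoyonedaMk (h ≫ f) :=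
  Finsupp.mapDomain_single

/-- An injective system of vector spaces takes epimorphisms to surjections. -/
theorem surjective_map_of_epi {F : C ⥤ ModuleCat.{max w v} ℚ} (hF : Injective F) {c c' : C}
    (e : c ⟶ c') [Epi e] : Function.Surjective (F.map e) := by
  intro a
  -- Precomposition with an epimorphism is injective on morphisms, hence on basis elements.
  have hj : Mono (freeCoyonedaMap.{v, w} e) := by
    rw [NatTrans.mono_iff_mono_app]
    intro d
    rw [ModuleCat.mono_iff_injective]
    refine Finsupp.mapDomain_injective ?_
    intro x y hxy
    have := congrArg ULift.down hxy
    exact ULift.ext _ _ ((cancel_epi e).mp this)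
  -- By Yoneda, `a` is a map out of the free system on `c'`; its extension to the free system on
  -- `c`, evaluated at the identity, is the required preimage.
  let h := Injective.factorThru (freeCoyonedaDesc.{v, w} a) (freeCoyonedaMap.{v, w} e)
  refine ⟨h.app c (freeCoyonedaMk (𝟙 c)), ?_⟩
  have e1 : (freeCoyonedaMap.{v, w} e ≫ h).app c' (freeCoyonedaMk (𝟙 c')) = a := by
    rw [Injective.comp_factorThru, freeCoyonedaDesc_mk]
    simp
  rw [← e1, ← ConcreteCategory.comp_apply, ← h.naturality, NatTrans.comp_app,
    ConcreteCategory.comp_apply, ConcreteCategory.comp_apply, freeCoyoneda_map_mk,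
    freeCoyonedaMap_mk, Category.id_comp, Category.comp_id]

end Epi

/-! ### The injectivity criterion over a two-orbit category -/

section Orbit

variable {G : Type v} [CommGroup G]

/-- The translation of the free orbit by an element of a commutative group. -/
def translate (a : G) : (⟨⊥⟩ : Orbit G) ⟶ ⟨⊥⟩ :=
  show (G ⧸ (⊥ : Subgroup G)) →[G] (G ⧸ (⊥ : Subgroup G)) from
  { toFun := fun x => a • x
    map_smul' := fun g x => smul_comm a g x }

theorem translate_comp (a b : G) : translate a ≫ translate b = translate (b * a) := by
  apply MulActionHom.ext
  intro x
  exact (mul_smul b a x).symm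

theorem translate_one : translate (1 : G) = 𝟙 _ := by
  apply MulActionHom.ext
  intro x
  exact one_smul G x

theorem exists_eq_translate (f : (⟨⊥⟩ : Orbit G) ⟶ ⟨⊥⟩) : ∃ a : G, f = translate a := by
  let f' : (G ⧸ (⊥ : Subgroup G)) →[G] (G ⧸ (⊥ : Subgroup G)) := f
  obtain ⟨a, ha⟩ := QuotientGroup.mk_surjective (f' (QuotientGroup.mk 1))
  refine ⟨a, ?_⟩
  apply MulActionHom.ext
  intro x
  obtain ⟨g, rfl⟩ := QuotientGroup.mk_surjective x
  have h1 : (QuotientGroup.mk g : G ⧸ (⊥ : Subgroup G)) = g • QuotientGroup.mk 1 := by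
    rw [MulAction.Quotient.smul_mk, smul_eq_mul, mul_one]
  change f' (QuotientGroup.mk g) = a • (QuotientGroup.mk g : G ⧸ (⊥ : Subgroup G))
  have h2 : (QuotientGroup.mk a : G ⧸ (⊥ : Subgroup G)) = a • QuotientGroup.mk 1 := by
    rw [MulAction.Quotient.smul_mk, smul_eq_mul, mul_one]
  rw [h1, map_smul, ← ha, smul_comm a g, h2]

instance : Subsingleton (G ⧸ (⊤ : Subgroup G)) :=
  QuotientGroup.subsingleton_quotient_top

/-- The projection of the free orbit onto the one-point orbit. -/
def toPoint : (⟨⊥⟩ : Orbit G) ⟶ ⟨⊤⟩ :=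
  show (G ⧸ (⊥ : Subgroup G)) →[G] (G ⧸ (⊤ : Subgroup G)) from
  { toFun := fun _ => QuotientGroup.mk 1
    map_smul' := fun _ _ => Subsingleton.elim (α := G ⧸ (⊤ : Subgroup G)) _ _ }

theorem hom_top_ext {c : Orbit G} (f g : c ⟶ ⟨⊤⟩) : f = g := by
  apply MulActionHom.ext
  intro x
  exact Subsingleton.elim (α := G ⧸ (⊤ : Subgroup G)) _ _

/-- The image of the point would be fixed by the group, but a nontrivial group acts on its free
orbit without fixed points. -/
theorem isEmpty_top_hom_bot [Nontrivial G] (f : (⟨⊤⟩ : Orbit G) ⟶ ⟨⊥⟩) : False := by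
  let f' : (G ⧸ (⊤ : Subgroup G)) →[G] (G ⧸ (⊥ : Subgroup G)) := f
  obtain ⟨a, ha⟩ := exists_ne (1 : G)
  obtain ⟨b, hb⟩ := QuotientGroup.mk_surjective (f' (QuotientGroup.mk 1))
  have h1 : a • f' (QuotientGroup.mk 1) = f' (QuotientGroup.mk 1) := by
    rw [← map_smul]
    congr 1
    exact Subsingleton.elim (α := G ⧸ (⊤ : Subgroup G)) _ _
  rw [← hb, MulAction.Quotient.smul_mk, QuotientGroup.eq, Subgroup.mem_bot, smul_eq_mul,
    mul_inv_rev, mul_right_comm, inv_mul_cancel, one_mul, inv_eq_one] at h1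
  exact ha h1

instance : Epi (toPoint : (⟨⊥⟩ : Orbit G) ⟶ ⟨⊤⟩) where
  left_cancellation {Z} f g h := by
    let f' : (G ⧸ (⊤ : Subgroup G)) →[G] (G ⧸ Z.sub) := f
    let g' : (G ⧸ (⊤ : Subgroup G)) →[G] (G ⧸ Z.sub) := g
    apply MulActionHom.ext
    intro x
    have := congrArg (fun k : (G ⧸ (⊥ : Subgroup G)) →[G] (G ⧸ Z.sub) => k (QuotientGroup.mk 1)) h
    obtain rfl : x = (QuotientGroup.mk 1 : G ⧸ (⊤ : Subgroup G)) :=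
      Subsingleton.elim (α := G ⧸ (⊤ : Subgroup G)) _ _
    exact this

/-- A linear map, averaged over the translations. -/
noncomputable def average [Fintype G] (Y V : VectSystem.{u} G) (h : Y.obj ⟨⊥⟩ ⟶ V.obj ⟨⊥⟩) :
    Y.obj ⟨⊥⟩ ⟶ V.obj ⟨⊥⟩ :=
  (Fintype.card G : ℚ)⁻¹ • ∑ a : G, Y.map (translate a⁻¹) ≫ h ≫ V.map (translate a)

theorem translate_comp_average [Fintype G] {Y V : VectSystem.{u} G}
    (h : Y.obj ⟨⊥⟩ ⟶ V.obj ⟨⊥⟩) (b : G) :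
    Y.map (translate b) ≫ average Y V h = average Y V h ≫ V.map (translate b) := by
  simp only [average, Linear.comp_smul, Linear.smul_comp, Preadditive.comp_sum,
    Preadditive.sum_comp, Category.assoc]
  congr 1
  -- With a' = b⁻¹a, one has a'⁻¹ = a⁻¹b and ba' = a, so the two sums agree term by term.
  refine Fintype.sum_equiv (Equiv.mulLeft b⁻¹) _ _ fun a => ?_
  simp only [← Functor.map_comp, ← Functor.map_comp_assoc, translate_comp, Equiv.coe_mulLeft,
    mul_inv_rev, inv_inv, mul_inv_cancel_left]

/-- Translations become invisible after projection to the point, so every summand equals the same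
map. -/
theorem average_comp [Fintype G] {Y V : VectSystem.{u} G} (h : Y.obj ⟨⊥⟩ ⟶ V.obj ⟨⊥⟩)
    (t : Y.obj ⟨⊤⟩ ⟶ V.obj ⟨⊤⟩) (ht : h ≫ V.map toPoint = Y.map toPoint ≫ t) :
    average Y V h ≫ V.map toPoint = Y.map toPoint ≫ t := by
  have : ∀ a : G, Y.map (translate a⁻¹) ≫ h ≫ V.map (translate a) ≫ V.map toPoint =
      Y.map toPoint ≫ t := fun a => by
    rw [← V.map_comp, hom_top_ext (translate a ≫ toPoint) toPoint, ht, ← Y.map_comp_assoc,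
      hom_top_ext (translate a⁻¹ ≫ toPoint) toPoint]
  simp only [average, Linear.smul_comp, Preadditive.sum_comp, Category.assoc, this,
    Finset.sum_const, Finset.card_univ, ← Nat.cast_smul_eq_nsmul ℚ, smul_smul]
  rw [inv_mul_cancel₀ (by exact_mod_cast Fintype.card_ne_zero), one_smul]

/-- Since `i` and `g` commute with translations, each summand restricts to `g` and so does the mean.
-/
theorem comp_average [Fintype G] {X Y V : VectSystem.{u} G} (i : X ⟶ Y) (g : X ⟶ V)
    (h : Y.obj ⟨⊥⟩ ⟶ V.obj ⟨⊥⟩) (hh : i.app ⟨⊥⟩ ≫ h = g.app ⟨⊥⟩) :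
    i.app ⟨⊥⟩ ≫ average Y V h = g.app ⟨⊥⟩ := by
  have : ∀ a : G, i.app ⟨⊥⟩ ≫ Y.map (translate a⁻¹) ≫ h ≫ V.map (translate a) =
      g.app ⟨⊥⟩ := fun a => by
    rw [← i.naturality_assoc, reassoc_of% hh, g.naturality_assoc, ← V.map_comp, translate_comp,
      mul_inv_cancel, translate_one, V.map_id, Category.comp_id]
  simp only [average, Linear.comp_smul, Preadditive.comp_sum, this,
    Finset.sum_const, Finset.card_univ, ← Nat.cast_smul_eq_nsmul ℚ, smul_smul]
  rw [inv_mul_cancel₀ (by exact_mod_cast Fintype.card_ne_zero), one_smul]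

/-- If the only orbits are the free one and the point, compatible equivariant maps at these two
orbits form a morphism of systems. -/
theorem exists_hom_of_app [Nontrivial G] (hG : ∀ H : Subgroup G, H = ⊥ ∨ H = ⊤)
    {Y V : VectSystem.{u} G} (b : Y.obj ⟨⊥⟩ ⟶ V.obj ⟨⊥⟩) (t : Y.obj ⟨⊤⟩ ⟶ V.obj ⟨⊤⟩)
    (hb : ∀ a : G, Y.map (translate a) ≫ b = b ≫ V.map (translate a))
    (hbt : b ≫ V.map toPoint = Y.map toPoint ≫ t) :
    ∃ φ : Y ⟶ V, φ.app ⟨⊥⟩ = b ∧ φ.app ⟨⊤⟩ = t := by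
  classical
  have hne : (⟨⊥⟩ : Orbit G) ≠ ⟨⊤⟩ := fun h => bot_ne_top (congrArg Orbit.sub h)
  -- An orbit equals one of the two standard ones only propositionally, so each component is
  -- specified up to transport by `eqToHom`; the two clauses never apply together.
  have hex : ∀ c : Orbit G, ∃ k : Y.obj c ⟶ V.obj c,
      (∀ h : c = ⟨⊥⟩, k = Y.map (eqToHom h) ≫ b ≫ V.map (eqToHom h.symm)) ∧
      (∀ h : c = ⟨⊤⟩, k = Y.map (eqToHom h) ≫ t ≫ V.map (eqToHom h.symm)) := by
    rintro ⟨H⟩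
    rcases hG H with rfl | rfl
    · exact ⟨b, fun _ => by simp, fun h => absurd h hne⟩
    · exact ⟨t, fun h => absurd h.symm hne, fun _ => by simp⟩
  choose k hkb hkt using hex
  have hkb' : k ⟨⊥⟩ = b := by simpa using hkb ⟨⊥⟩ rfl
  have hkt' : k ⟨⊤⟩ = t := by simpa using hkt ⟨⊤⟩ rfl
  refine ⟨⟨k, ?_⟩, hkb', hkt'⟩
  rintro ⟨H⟩ ⟨K⟩ f
  rcases hG H with rfl | rfl <;> rcases hG K with rfl | rfl
  · obtain ⟨a, rfl⟩ := exists_eq_translate f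
    rw [hkb', hb]
  · rw [hom_top_ext f toPoint, hkb', hkt', hbt]
  · exact (isEmpty_top_hom_bot f).elim
  · rw [hom_top_ext f (𝟙 _)]
    simp

/-- Extend the map at the point first, then choose an extension at the free orbit lying over it, and
make the latter equivariant by averaging, which disturbs neither property. -/
theorem injective_of_surjective [Fintype G] [Nontrivial G]
    (hG : ∀ H : Subgroup G, H = ⊥ ∨ H = ⊤) {V : VectSystem.{u} G}
    (hV : Function.Surjective (V.map (toPoint : (⟨⊥⟩ : Orbit G) ⟶ ⟨⊤⟩))) : Injective V := by
  constructor
  intro X Y g i hi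
  have hi' : ∀ c, ∃ r : Y.obj c ⟶ X.obj c, i.app c ≫ r = 𝟙 _ := by
    intro c
    have hm : Mono (i.app c) := inferInstance
    rw [ModuleCat.mono_iff_injective] at hm
    obtain ⟨r, hr⟩ := LinearMap.exists_leftInverse_of_injective (i.app c).hom
      (LinearMap.ker_eq_bot.mpr hm)
    exact ⟨ModuleCat.ofHom r, ModuleCat.hom_ext hr⟩
  obtain ⟨s, hs⟩ : ∃ s : V.obj ⟨⊤⟩ ⟶ V.obj ⟨⊥⟩, s ≫ V.map toPoint = 𝟙 _ := by
    obtain ⟨s, hs⟩ := LinearMap.exists_rightInverse_of_surjective (V.map toPoint).hom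
      (LinearMap.range_eq_top.mpr hV)
    exact ⟨ModuleCat.ofHom s, ModuleCat.hom_ext hs⟩
  obtain ⟨rt, hrt⟩ := hi' ⟨⊤⟩
  obtain ⟨r, hr⟩ := hi' ⟨⊥⟩
  let t := rt ≫ g.app ⟨⊤⟩
  have ht : i.app ⟨⊤⟩ ≫ t = g.app ⟨⊤⟩ := by simp only [t, reassoc_of% hrt]
  -- On the image of `X` this is `g`; on the complement cut out by the retraction `r` it goes down
  -- to the point, across by `t`, and back up by the section `s`, which forces compatibility with
  -- the projection.
  let h := r ≫ g.app ⟨⊥⟩ + (𝟙 _ - r ≫ i.app ⟨⊥⟩) ≫ Y.map toPoint ≫ t ≫ s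
  have hh : i.app ⟨⊥⟩ ≫ h = g.app ⟨⊥⟩ := by
    simp only [h, Preadditive.comp_add, Preadditive.sub_comp, Preadditive.comp_sub,
      Category.assoc, reassoc_of% hr, Category.id_comp]
    simp
  have hht : h ≫ V.map toPoint = Y.map toPoint ≫ t := by
    simp only [h, Preadditive.add_comp, Preadditive.sub_comp, Category.assoc, hs,
      Category.comp_id, Category.id_comp, ← i.naturality_assoc, ht, ← g.naturality]
    abel
  obtain ⟨φ, hφb, hφt⟩ := exists_hom_of_app hG (average Y V h) t (translate_comp_average h)
    (average_comp h t hht)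
  refine ⟨φ, ?_⟩
  apply NatTrans.ext
  funext ⟨c⟩
  rcases hG c with rfl | rfl
  · rw [NatTrans.comp_app, hφb, comp_average i g h hh]
  · rw [NatTrans.comp_app, hφt, ht]

end Orbit

/-! ### Quasi-isomorphisms to algebras with zero differential -/

theorem DGAlg.Hom.exists_cocycle {A B : DGAlg.{u}} {f : DGAlg.Hom A B} (hB : B.d = 0)
    (hf : Function.Bijective f.mapCohomology) {k : ℕ} {b : B} (hb : b ∈ B.grade k) :
    ∃ z ∈ A.grade k, A.d z = 0 ∧ f.toAlgHom z = b := by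
  have hb0 : b ∈ LinearMap.ker B.d := by rw [LinearMap.mem_ker, hB, LinearMap.zero_apply]
  obtain ⟨q, hq⟩ := hf.2 (Submodule.Quotient.mk ⟨b, hb0⟩)
  obtain ⟨z, rfl⟩ := Submodule.Quotient.mk_surjective _ q
  have hz : f.toAlgHom z.1 = b := by
    obtain ⟨y, hy⟩ := (Submodule.Quotient.eq _).mp hq
    exact sub_eq_zero.mp (hy.symm.trans (DFunLike.congr_fun hB y))
  -- Total cohomology only supplies a possibly inhomogeneous `z`; its degree `k` component is still
  -- a cocycle and still maps to `b`.
  refine ⟨GradedAlgebra.proj A.grade k z, A.proj_mem k _, ?_, ?_⟩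
  · rw [A.d_proj, LinearMap.mem_ker.mp z.2, map_zero]
  · rw [f.map_proj, hz, B.proj_of_mem hb]

theorem DGAlg.Hom.exists_d_eq {A B : DGAlg.{u}} {f : DGAlg.Hom A B}
    (hf : Function.Bijective f.mapCohomology) {k : ℕ} {z : A} (hz : z ∈ A.grade (k + 1))
    (hdz : A.d z = 0) (hfz : f.toAlgHom z = 0) : ∃ y ∈ A.grade k, A.d y = z := by
  have h0 : (Submodule.Quotient.mk ⟨z, hdz⟩ : A.Cohomology) = 0 := by
    apply hf.1
    rw [map_zero]
    have : f.mapCocycles ⟨z, hdz⟩ = 0 := Subtype.ext hfz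
    exact (congrArg Submodule.Quotient.mk this).trans (Submodule.Quotient.mk_zero _)
  obtain ⟨y, hy⟩ := (Submodule.Quotient.mk_eq_zero _).mp h0
  refine ⟨GradedAlgebra.proj A.grade k y, A.proj_mem k y, ?_⟩
  rw [A.d_proj, hy]
  exact A.proj_of_mem hz

/-! ### Resolutions of systems of vector spaces -/

variable {G : Type v} [Group G]

/-- The augmentation `V → V₀` of an injective resolution. -/
def resAug {V : VectSystem.{u} G} (R : InjectiveResolution V) : V ⟶ R.cocomplex.X 0 := R.ι.f 0

theorem resAug_injective {V : VectSystem.{u} G} (R : InjectiveResolution V) (c : Orbit G) :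
    Function.Injective ((resAug R).app c) := by
  have : Mono (resAug R) := inferInstanceAs (Mono (R.ι.f 0))
  have hm : Mono ((resAug R).app c) := inferInstance
  rwa [ModuleCat.mono_iff_injective] at hm

theorem d_resAug {V : VectSystem.{u} G} (R : InjectiveResolution V) (c : Orbit G) (v : V.obj c) :
    (R.cocomplex.d 0 1).app c ((resAug R).app c v) = 0 := by
  have h : resAug R ≫ R.cocomplex.d 0 1 = 0 := R.ι_f_zero_comp_complex_d
  have h' := congrArg (fun φ => φ.app c v) h
  exact h'

/-- Evaluation at an orbit is exact, so it preserves exactness of the resolution at `V₀`. -/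
theorem exists_resAug_eq {V : VectSystem.{u} G} (R : InjectiveResolution V) (c : Orbit G)
    (x : (R.cocomplex.X 0).obj c) (hx : (R.cocomplex.d 0 1).app c x = 0) :
    ∃ v : V.obj c, (resAug R).app c v = x := by
  have h := R.exact₀.map ((evaluation _ _).obj c)
  rw [ShortComplex.moduleCat_exact_iff] at h
  exact h x hx

/-! ### The stages of a minimal system -/

namespace MinimalSystem

variable (M : MinimalSystem.{u} G) (c : Orbit G)

theorem isFreeExtension {n : ℕ} (hn : 1 ≤ n) :
    IsFreeExtension ((M.incl n).app c).toHom (n + 1)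
      (fun i => level ((M.ext n hn).gen i) c) :=
  (M.ext n hn).free c

theorem toTotal_incl (n : ℕ) (x : (M.stage n).obj c) :
    ((M.toTotal (n + 1)).app c).toAlgHom (((M.incl n).app c).toAlgHom x) =
      ((M.toTotal n).app c).toAlgHom x := by
  rw [← M.incl_toTotal n]
  rfl

theorem stage_nontrivial (n : ℕ) : Nontrivial ((M.stage n).obj c) := by
  have h0 : Nontrivial ((M.stage 0).obj c) := (M.stage_zero c).1.nontrivial
  have ht : Nontrivial (M.total.obj c) := (M.toTotal_injective 0 c).nontrivial
  exact ((M.toTotal n).app c).toAlgHom.toRingHom.domain_nontrivial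

theorem stage_isConnected {n : ℕ} (hn : 1 ≤ n) :
    ((M.stage n).obj c).toGrAlg.IsConnected := by
  induction n, hn using Nat.le_induction with
  | base => exact ⟨M.stage_nontrivial c 1, fun x _ => (M.stage_one c).2 x |>.imp fun _ h => h.symm⟩
  | succ n hn ih =>
    refine ⟨M.stage_nontrivial c (n + 1), fun x hx => ?_⟩
    obtain ⟨a, ha, rfl⟩ := (M.isFreeExtension c hn).exists_of_lt ih
      (fun i x => (M.ext n hn).gen_mem i c x) (Nat.succ_pos n) hx
    obtain ⟨q, rfl⟩ := ih.scalar a ha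
    exact ⟨q, ((M.incl n).app c).toAlgHom.commutes q⟩

/-- In degrees `≤ n`, the stage `Mₙ` is already all of `M`. -/
theorem exists_stage {n k : ℕ} (hn : 1 ≤ n) (hk : k ≤ n) {x : M.total.obj c}
    (hx : x ∈ (M.total.obj c).grade k) :
    ∃ y ∈ ((M.stage n).obj c).grade k, ((M.toTotal n).app c).toAlgHom y = x := by
  obtain ⟨N, y, hy⟩ := M.exhausts c x
  -- An element of `M` is first pushed up to a stage beyond `n`, then brought down: every stage past
  -- `n` adds generators only in degrees above `n`, hence above `k`.
  have up : ∀ N' ≥ N, ∃ y' ∈ ((M.stage N').obj c).grade k,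
      ((M.toTotal N').app c).toAlgHom y' = x := by
    intro N' hN'
    induction N', hN' using Nat.le_induction with
    | base =>
      refine ⟨GradedAlgebra.proj _ k y, GrAlg.proj_mem _ k y, ?_⟩
      rw [((M.toTotal N).app c).map_proj, hy, GrAlg.proj_of_mem _ hx]
    | succ N' _ ih =>
      obtain ⟨y', hy', rfl⟩ := ih
      exact ⟨_, ((M.incl N').app c).map_mem hy', M.toTotal_incl c N' y'⟩
  have down : ∀ N' ≥ n, (∃ y' ∈ ((M.stage N').obj c).grade k,
      ((M.toTotal N').app c).toAlgHom y' = x) →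
      ∃ y' ∈ ((M.stage n).obj c).grade k, ((M.toTotal n).app c).toAlgHom y' = x := by
    intro N' hN'
    induction N', hN' using Nat.le_induction with
    | base => exact id
    | succ N' hN' ih =>
      rintro ⟨y', hy', rfl⟩
      obtain ⟨a, ha, rfl⟩ := (M.isFreeExtension c (hn.trans hN')).exists_of_lt
        (M.stage_isConnected c (hn.trans hN')) (fun i x => (M.ext N' _).gen_mem i c x)
        (show k < N' + 1 by omega) hy'
      exact ih ⟨a, ha, (M.toTotal_incl c N' a).symm⟩
  exact down (max N n) (le_max_right _ _) (up _ (le_max_left _ _))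

end MinimalSystem

/-- If the structure map `A(G/H) → A(G/K)` is surjective and the elements of `Vₙ₊₁(G/K)` have
trivial attaching map, then `Vₙ₊₁(G/H) → Vₙ₊₁(G/K)` is surjective. -/
theorem MinimalModel.surjective_vec_map {A : GADiagram.{u} G}
    (M : MinimalModel (A ⋙ GrAlg.zeroD)) {n : ℕ} (hn : 1 ≤ n) {c c' : Orbit G} (t : c ⟶ c')
    (hA : Function.Surjective (A.map t).toAlgHom)
    (hM : ((M.stage n).obj c').grade (n + 1 + 1) = ⊥) :
    Function.Surjective ((M.vec (n + 1)).map t) := by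
  intro v
  let E := M.ext n hn
  have conn := M.stage_isConnected c hn
  have conn' := M.stage_isConnected c' hn
  let y := (resAug E.res).app c' v
  let s := level (E.gen 0) c' y
  have hs : s ∈ ((M.stage (n + 1)).obj c').grade (n + 1) := E.gen_mem 0 c' y
  -- The attaching term lies in the vanishing degree, and the resolution term dies because `y` comes
  -- from `V`.
  have hds : ((M.stage (n + 1)).obj c').d s = 0 := by
    have h0 : level (E.attach 0) c' y = 0 := by
      have := E.attach_mem 0 c' y
      rwa [add_zero, hM, Submodule.mem_bot] at this
    have h1 := E.d_gen 0 c' y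
    rwa [h0, d_resAug, map_zero, map_zero, smul_zero, add_zero] at h1
  let T := (M.toTotal (n + 1)).app c
  let T' := (M.toTotal (n + 1)).app c'
  let ρs := (M.ρ.app c').toAlgHom (T'.toAlgHom s)
  have hρs : ρs ∈ (A.obj c').grade (n + 1) := (M.ρ.app c').map_mem (T'.map_mem hs)
  obtain ⟨a, ha, haρ⟩ : ∃ a ∈ (A.obj c).grade (n + 1), (A.map t).toAlgHom a = ρs := by
    obtain ⟨a, ha⟩ := hA ρs
    refine ⟨GradedAlgebra.proj _ (n + 1) a, GrAlg.proj_mem _ _ _, ?_⟩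
    rw [(A.map t).map_proj, ha, GrAlg.proj_of_mem _ hρs]
  obtain ⟨z, hz, hdz, hza⟩ := DGAlg.Hom.exists_cocycle (f := M.ρ.app c) rfl (M.quasiIso c) ha
  obtain ⟨z, hz', rfl⟩ := M.exists_stage c (Nat.le_add_left 1 n) le_rfl hz
  have hdz' : ((M.stage (n + 1)).obj c).d z = 0 := by
    apply M.toTotal_injective (n + 1) c
    rw [((M.toTotal (n + 1)).app c).map_d, hdz, map_zero]
  obtain ⟨b, hb, x, rfl⟩ := (M.isFreeExtension c hn).exists_of_mem_grade (Nat.succ_pos n) conn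
    (fun i x => E.gen_mem i c x) hz'
  -- The equation `dz = 0` places the `V₁`-generator of `w₀ x` in the image of stage `n`, and
  -- generators are independent of that stage.
  have hx : (E.res.cocomplex.d 0 1).app c x = 0 := by
    refine (M.isFreeExtension c hn).eq_zero_of_gen_eq (i := 1) (Nat.succ_pos n) conn
      (a := -(((M.stage n).obj c).d b + level (E.attach 0) c x)) ?_
    have h1 := E.d_gen 0 c x
    have h2 : ((M.stage (n + 1)).obj c).d (((M.incl n).app c).toAlgHom b) +
        ((M.stage (n + 1)).obj c).d (level (E.gen 0) c x) = 0 := by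
      rw [← map_add]
      exact hdz'
    rw [← ((M.incl n).app c).map_d, h1, pow_zero, one_smul] at h2
    change level (E.gen 1) c _ = ((M.incl n).app c).toAlgHom _
    rw [map_neg, map_add]
    refine eq_neg_of_add_eq_zero_right ?_
    rw [← h2, add_assoc]
  obtain ⟨u, rfl⟩ := exists_resAug_eq E.res c x hx
  refine ⟨u, resAug_injective E.res c' ?_⟩
  let z := ((M.incl n).app c).toAlgHom b + level (E.gen 0) c ((resAug E.res).app c u)
  let z' := ((M.stage (n + 1)).map t).toAlgHom z
  have hzmem : z ∈ ((M.stage (n + 1)).obj c).grade (n + 1) := hz'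
  have hzd : ((M.stage (n + 1)).obj c).d z = 0 := hdz'
  have hzρ : (M.ρ.app c).toAlgHom (T.toAlgHom z) = a := hza
  have hz'mem : z' - s ∈ ((M.stage (n + 1)).obj c').grade (n + 1) :=
    sub_mem (((M.stage (n + 1)).map t).map_mem hzmem) hs
  have hz'd : ((M.stage (n + 1)).obj c').d (z' - s) = 0 := by
    rw [map_sub, hds, sub_zero, ← ((M.stage (n + 1)).map t).map_d, hzd, map_zero]
  have hz'ρ : (M.ρ.app c').toAlgHom (T'.toAlgHom (z' - s)) = 0 := by
    have h1 : T'.toAlgHom z' = (M.total.map t).toAlgHom (T.toAlgHom z) :=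
      DFunLike.congr_fun (congrArg (fun φ => φ.toAlgHom) ((M.toTotal (n + 1)).naturality t)) z
    have h2 : (M.ρ.app c').toAlgHom ((M.total.map t).toAlgHom (T.toAlgHom z)) =
        (A.map t).toAlgHom ((M.ρ.app c).toAlgHom (T.toAlgHom z)) :=
      DFunLike.congr_fun (congrArg (fun φ => φ.toAlgHom) (M.ρ.naturality t)) (T.toAlgHom z)
    rw [map_sub, map_sub, h1, h2, hzρ, haρ]
    exact sub_self ρs
  obtain ⟨y₀, hy₀, hdy₀⟩ := DGAlg.Hom.exists_d_eq (M.quasiIso c') (T'.map_mem hz'mem)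
    (by rw [← T'.map_d, hz'd, map_zero]) hz'ρ
  -- The primitive has degree `n`, one below the new generators, so it already lies in stage `n`;
  -- therefore so does `z' - s`.
  obtain ⟨y₁, -, rfl⟩ := M.exists_stage c' hn le_rfl hy₀
  have hy₁ : ((M.incl n).app c').toAlgHom (((M.stage n).obj c').d y₁) = z' - s := by
    apply M.toTotal_injective (n + 1) c'
    rw [M.toTotal_incl, ((M.toTotal n).app c').map_d, hdy₀]
  have hz'eq : z' = ((M.incl n).app c').toAlgHom (((M.stage n).map t).toAlgHom b) +
      level (E.gen 0) c' ((E.res.cocomplex.X 0).map t ((resAug E.res).app c u)) := by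
    have h1 : ((M.incl n).app c').toAlgHom (((M.stage n).map t).toAlgHom b) =
        ((M.stage (n + 1)).map t).toAlgHom (((M.incl n).app c).toAlgHom b) :=
      DFunLike.congr_fun (congrArg (fun φ => φ.toAlgHom) ((M.incl n).naturality t)) b
    have h2 : level (E.gen 0) c' ((E.res.cocomplex.X 0).map t ((resAug E.res).app c u)) =
        ((M.stage (n + 1)).map t).toAlgHom (level (E.gen 0) c ((resAug E.res).app c u)) :=
      ConcreteCategory.congr_hom ((E.gen 0).naturality t) ((resAug E.res).app c u)
    rw [h1, h2]
    exact map_add _ _ _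
  have hnat : (resAug E.res).app c' ((M.vec (n + 1)).map t u) =
      (E.res.cocomplex.X 0).map t ((resAug E.res).app c u) :=
    ConcreteCategory.congr_hom ((resAug E.res).naturality t) u
  rw [hnat, ← sub_eq_zero]
  -- The difference of the two `V₀`-generators equals `d y₁` minus the image of `b`, both from stage
  -- `n`, so independence makes it zero.
  refine (M.isFreeExtension c' hn).eq_zero_of_gen_eq (i := 0) (Nat.succ_pos n) conn'
    (a := ((M.stage n).obj c').d y₁ - ((M.stage n).map t).toAlgHom b) ?_
  change level (E.gen 0) c' _ = ((M.incl n).app c').toAlgHom _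
  rw [map_sub, map_sub, hy₁, hz'eq]
  change _ - s = _
  abel

end EquivMin

theorem mainTheorem5 (p : ℕ) [Fact p.Prime]
    (A : EquivMin.GADiagram.{u} (Multiplicative (ZMod p)))
    (hA : EquivMin.GAInjective A)
    (M : EquivMin.MinimalModel (A ⋙ EquivMin.GrAlg.zeroD))
    (n : ℕ) (hn : 2 ≤ n)
    (hM : ((M.stage (n - 1)).obj ⟨⊤⟩).grade (n + 1) = ⊥) :
    CategoryTheory.Injective (M.associatedSystem n) := by
  obtain ⟨m, rfl⟩ : ∃ m, n = m + 1 := ⟨n - 1, by omega⟩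
  have : NeZero p := ⟨(Fact.out : p.Prime).ne_zero⟩
  have : Nontrivial (Multiplicative (ZMod p)) :=
    have : Fact (1 < p) := ⟨(Fact.out : p.Prime).one_lt⟩
    inferInstanceAs (Nontrivial (ZMod p))
  have hcard : (Nat.card (Multiplicative (ZMod p))).Prime := by
    rw [Nat.card_congr Multiplicative.toAdd, Nat.card_zmod]
    exact Fact.out
  have : Fact (Nat.card (Multiplicative (ZMod p))).Prime := ⟨hcard⟩
  refine EquivMin.injective_of_surjective (fun H => H.eq_bot_or_eq_top_of_prime_card) ?_
  exact M.surjective_vec_map (by omega) EquivMin.toPoint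
    (EquivMin.surjective_map_of_epi.{0, u} hA EquivMin.toPoint) hM
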